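/- For a partition $\lambda$ of $n$ let $\chi_\lambda$ denote the irreducible complex representation of $S_n$ (the Specht module) labelled by $\lambda$. Write $\rho\le\sigma$ if $\rho$ is isomorphic to a subrepresentation of $\sigma$. Let $w_n=(1\,2\,\cdots\,n)$ and let $D_n=\langle w_n,\ (1\ n)(2\ n-1)\cdots\rangle\le S_n$ be the dihedral group of order $2n$ for $n \ge 3$; its reflections are its elements outside $\langle w_n\rangle$. Let $n=2m$ with $m>1$, and regard $S_m\times S_m$ as the Young subgroup of $S_n$ whose factors permute $\{1,\dots,m\}$ and $\{m+1,\dots,2m\}$. Let $\mu^1\neq\mu^2$ be partitions of $m$ and let $\lambda$ be a partition of $n$ such that $$\chi_{\mu^1}\times\chi_{\mu^2}\ \le\ \operatorname{Res}^{S_n}_{S_m\times S_m}\chi_\lambda .$$ Then there is a reflection $s\in D_n$ such that the subgroup $H=\langle w_n^2,s\rangle$ of $D_n$ is conjugate in $S_n$ to a subgroup of $S_m\times S_m$ and, for every $g\in S_n$ with $gHg^{-1}\le S_m\times S_m$, $$\operatorname{Ind}_{H}^{D_n}\Big(\big(\chi_{\mu^1}\times\chi_{\mu^2}\big)\circ c_g\Big)\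 \le\ \operatorname{Res}^{S_n}_{D_n}\chi_\lambda,\qquad c_g\colon H\to S_m\times S_m,\quad c_g(h)=ghg^{-1}.$$ -/

import Mathlib

open scoped TensorProduct

noncomputable section

namespace DihedralRestriction

/-! ### Irreducible representations of the symmetric groups -/

/-- The parts of a partition, in weakly decreasing order. -/
def rows {n : ℕ} (lam : n.Partition) : List ℕ :=
  lam.parts.sort (· ≥ ·)

theorem rows_sortedGE {n : ℕ} (lam : n.Partition) : (rows lam).SortedGE :=
  (Multiset.pairwise_sort lam.parts (· ≥ ·)).sortedGE

theorem rows_sum {n : ℕ} (lam : n.Partition) : (rows lam).sum = n := by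
  rw [← Multiset.sum_coe, rows, Multiset.sort_eq, lam.parts_sum]

/-- The Young diagram of a partition: row `i` has as many cells as the `i`-th largest part. -/
def diagram {n : ℕ} (lam : n.Partition) : YoungDiagram :=
  YoungDiagram.ofRowLens (rows lam) (rows_sortedGE lam)

theorem card_cellsOfRowLens (w : List ℕ) : (YoungDiagram.cellsOfRowLens w).card = w.sum := by
  induction w with
  | nil => simp [YoungDiagram.cellsOfRowLens]
  | cons a l ih =>
    rw [YoungDiagram.cellsOfRowLens, Finset.card_union_of_disjoint]
    · simp [ih]
    · rw [Finset.disjoint_left]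
      rintro ⟨i, j⟩ h1 h2
      simp at h1 h2
      omega

theorem card_cells {n : ℕ} (lam : n.Partition) : (diagram lam).cells.card = n :=
  (card_cellsOfRowLens (rows lam)).trans (rows_sum lam)

/-- A bijective filling of the Young diagram of `lam` with the entries `0, …, n - 1`
(another filling leads to a conjugate Young symmetrizer, hence to an isomorphic module). -/
def tableau {n : ℕ} (lam : n.Partition) : Fin n ≃ (diagram lam).cells :=
  ((diagram lam).cells.equivFinOfCardEq (card_cells lam)).symm

/-- The permutations of the entries that keep every entry in its row. -/
def rowStabilizer {n : ℕ} (lam : n.Partition) : Finset (Equiv.Perm (Fin n)) :=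
  Finset.univ.filter fun g => ∀ i, (tableau lam (g i)).1.1 = (tableau lam i).1.1

/-- The permutations of the entries that keep every entry in its column. -/
def columnStabilizer {n : ℕ} (lam : n.Partition) : Finset (Equiv.Perm (Fin n)) :=
  Finset.univ.filter fun g => ∀ i, (tableau lam (g i)).1.2 = (tableau lam i).1.2

/-- The Young symmetrizer `c = a * b` in `ℂ[S_n]`, with `a` the sum over the row stabilizer and `b`
the signed sum over the column stabilizer. -/
def youngSymmetrizer {n : ℕ} (lam : n.Partition) : MonoidAlgebra ℂ (Equiv.Perm (Fin n)) :=
  (∑ g ∈ rowStabilizer lam, MonoidAlgebra.of ℂ (Equiv.Perm (Fin n)) g) *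
    ∑ g ∈ columnStabilizer lam,
      ((Equiv.Perm.sign g : ℤ) : ℂ) • MonoidAlgebra.of ℂ (Equiv.Perm (Fin n)) g

/-- The Specht module `ℂ[S_n] c`, the left ideal generated by the Young symmetrizer. -/
abbrev SpechtModule {n : ℕ} (lam : n.Partition) :
    Submodule (MonoidAlgebra ℂ (Equiv.Perm (Fin n))) (MonoidAlgebra ℂ (Equiv.Perm (Fin n))) :=
  Submodule.span (MonoidAlgebra ℂ (Equiv.Perm (Fin n))) {youngSymmetrizer lam}

/-- The irreducible representation `χ_lam` of `S_n`: left multiplication on the Specht module. -/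
def specht {n : ℕ} (lam : n.Partition) :
    Representation ℂ (Equiv.Perm (Fin n)) (SpechtModule lam) :=
  Representation.ofModule' (SpechtModule lam)

/-! ### Containment, outer tensor products -/

/-- `ρ ≤ σ`: the representation `ρ` is isomorphic to a subrepresentation of `σ`. -/
def IsContained {G V W : Type*} [Monoid G] [AddCommMonoid V] [Module ℂ V] [AddCommMonoid W]
    [Module ℂ W] (ρ : Representation ℂ G V) (σ : Representation ℂ G W) : Prop :=
  ∃ f : Representation.IntertwiningMap ρ σ, Function.Injective f

/-- The outer tensor product `ρ × σ`, a representation of `G × H` on `V ⊗ W`. -/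
def outerTensor {G H V W : Type*} [Monoid G] [Monoid H] [AddCommMonoid V] [Module ℂ V]
    [AddCommMonoid W] [Module ℂ W] (ρ : Representation ℂ G V) (σ : Representation ℂ H W) :
    Representation ℂ (G × H) (V ⊗[ℂ] W) :=
  Representation.tprod (ρ.comp (MonoidHom.fst G H)) (σ.comp (MonoidHom.snd G H))

/-! ### Subgroups of the symmetric group -/

/-- The embedding of `S_m × S_m` into `S_{2m}` as a Young subgroup: the first factor permutes
`0, …, m - 1` and the second one permutes `m, …, 2m - 1`. -/
def youngEmbedding (m : ℕ) :
    Equiv.Perm (Fin m) × Equiv.Perm (Fin m) →* Equiv.Perm (Fin (2 * m)) :=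
  (finSumFinEquiv.trans (finCongr (two_mul m).symm)).permCongrHom.toMonoidHom.comp
    (Equiv.Perm.sumCongrHom (Fin m) (Fin m))

/-- The dihedral subgroup `D_n` of `S_n`, generated by the `n`-cycle `i ↦ i + 1` and the
reflection `i ↦ n - 1 - i` of `{0, …, n - 1}`. -/
def dihedral (n : ℕ) : Subgroup (Equiv.Perm (Fin n)) :=
  Subgroup.closure {finRotate n, Fin.revPerm}

/-- The rotation `w_n`, as an element of `D_n`. -/
def rotation (n : ℕ) : dihedral n :=
  ⟨finRotate n, Subgroup.subset_closure (Set.mem_insert _ _)⟩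

/-- A reflection of `D_n` (for `n ≥ 3`): an element of `D_n` that is not a rotation. -/
def IsReflection {n : ℕ} (s : dihedral n) : Prop :=
  s ∉ Subgroup.zpowers (rotation n)

/-- The subgroup `⟨w_n ^ 2, s⟩` of `D_n`. -/
def subgroupSq {n : ℕ} (s : dihedral n) : Subgroup (dihedral n) :=
  Subgroup.closure {rotation n ^ 2, s}

/-- `φ` is the embedding of the subgroup `H` of `D_{2m}` into `S_m × S_m` given by
conjugation with `g ∈ S_{2m}`. -/
def IsConjEmbedding {m : ℕ} (H : Subgroup (dihedral (2 * m))) (g : Equiv.Perm (Fin (2 * m)))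
    (φ : H →* Equiv.Perm (Fin m) × Equiv.Perm (Fin m)) : Prop :=
  ∀ h : H, youngEmbedding m (φ h) = g * ((h : dihedral (2 * m)) : Equiv.Perm (Fin (2 * m))) * g⁻¹

end DihedralRestriction

end

/-!
Write `H = ⟨w ^ 2, s⟩` and `Y = S_m × S_m`, and let `s` be a reflection preserving the parity of the
points. Then `H` has index two in `D_{2m}`, and its two orbits, the even and the odd points, have
`m` elements each. So `H` is conjugate into `Y`, and whenever `g` conjugates `H` into `Y`, it
carries the two orbits to the two halves. As `w` exchanges the orbits, `g w g⁻¹` lies in `τ Y`,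
where `τ` exchanges the halves (`exists_conj_rotation_eq`).

Let `U` be a copy of `χ_{mu1} × χ_{mu2}` in `χ_lam`. Its translate `τ U` is a copy of
`χ_{mu2} × χ_{mu1}`, and `mu1 ≠ mu2` forces `U ∩ τ U = 0` (`eq_zero_of_map_eq_halvesSwap_map`).
Hence `g⁻¹ U` is an `H`-stable copy of `(χ_{mu1} × χ_{mu2}) ∘ c_g` meeting its translate under `w`
trivially, and the `D_{2m}`-module that it generates is the induced one (`isContained_ind`).

Neither the irreducibility of the Specht modules nor a classification is needed for `U ∩ τ U = 0`.
The Young symmetrizers satisfy `c_lam x c_mu = 0` for `lam ≠ mu`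
(`youngSymmetrizer_mul_mul_eq_zero`): if `mu` does not dominate `lam`, a transposition inside
a row of `lam` and a column of `mu` gives this, and the opposite order follows since the group
algebra, being semisimple, has no nonzero `v` with `v x v = 0` for all `x`. So the two-sided ideal
of `c_mu1` kills `χ_{mu2}`, while by the same semisimplicity it kills no nonzero vector of
`χ_{mu1}`.
-/

open scoped TensorProduct

namespace DihedralRestriction

/-! ### Dominance of partitions and Young symmetrizers -/

/-- The number of cells in the first `k` rows of the diagram of `lam`, that is
`lam_1 + ⋯ + lam_k`; these numbers define the dominance order. -/
def rowCount {n : ℕ} (lam : n.Partition) (k : ℕ) : ℕ :=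
  ((diagram lam).cells.filter fun c => c.1 < k).card

theorem rowCount_eq_card_entries {n : ℕ} (lam : n.Partition) (k : ℕ) :
    rowCount lam k = (Finset.univ.filter fun i => (tableau lam i).1.1 < k).card := by
  symm
  refine Finset.card_bij (fun i _ => (tableau lam i).1) ?_ ?_ ?_
  · intro i hi
    simpa using hi
  · intro i _ j _ h
    exact (tableau lam).injective (Subtype.ext h)
  · intro c hc
    rw [Finset.mem_filter] at hc
    exact ⟨(tableau lam).symm ⟨c, hc.1⟩, by simpa using hc.2, by simp⟩

theorem rowCount_succ {n : ℕ} (lam : n.Partition) (k : ℕ) :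
    rowCount lam (k + 1) = rowCount lam k + (diagram lam).rowLen k := by
  rw [rowCount, rowCount, YoungDiagram.rowLen_eq_card, YoungDiagram.row,
    ← Finset.card_union_of_disjoint, ← Finset.filter_or]
  · simp only [Nat.lt_succ_iff_lt_or_eq]
  · rw [Finset.disjoint_filter]
    intro c _ h
    exact h.ne

theorem diagram_injective {n : ℕ} : Function.Injective (diagram (n := n)) := by
  intro lam mu h
  have hpos (nu : n.Partition) : ∀ x ∈ rows nu, 0 < x := fun x hx =>
    nu.parts_pos ((Multiset.mem_sort _).1 hx)
  have hrows : rows lam = rows mu := by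
    rw [← YoungDiagram.rowLens_ofRowLens_eq_self (hw := rows_sortedGE lam) (hpos lam),
      ← YoungDiagram.rowLens_ofRowLens_eq_self (hw := rows_sortedGE mu) (hpos mu)]
    exact congrArg YoungDiagram.rowLens h
  apply Nat.Partition.ext
  rw [← Multiset.sort_eq lam.parts (· ≥ ·), ← Multiset.sort_eq mu.parts (· ≥ ·)]
  exact congrArg _ hrows

/-- The dominance order is antisymmetric. -/
theorem eq_of_rowCount_eq {n : ℕ} {lam mu : n.Partition}
    (h : ∀ k, rowCount lam k = rowCount mu k) : lam = mu := by
  apply diagram_injective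
  apply YoungDiagram.ext
  ext ⟨i, j⟩
  have hi := rowCount_succ lam i
  rw [h, h, rowCount_succ, Nat.add_left_cancel_iff] at hi
  rw [YoungDiagram.mem_cells, YoungDiagram.mem_cells, YoungDiagram.mem_iff_lt_rowLen,
    YoungDiagram.mem_iff_lt_rowLen, hi]

/-- If any two entries in one row of the tableau of `lam` lie in different columns of the
tableau of `mu` permuted by `σ`, then `mu` dominates `lam`: the first `k` rows of `lam` put at most
`k` entries into each column of `mu`. -/
theorem rowCount_le_of_separated {n : ℕ} (lam mu : n.Partition) (σ : Equiv.Perm (Fin n))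
    (h : ∀ i j, i ≠ j → (tableau lam (σ i)).1.1 = (tableau lam (σ j)).1.1 →
      (tableau mu i).1.2 ≠ (tableau mu j).1.2) (k : ℕ) :
    rowCount lam k ≤ rowCount mu k := by
  have hσ : rowCount lam k =
      (Finset.univ.filter fun i => (tableau lam (σ i)).1.1 < k).card := by
    rw [rowCount_eq_card_entries]
    symm
    refine Finset.card_bij (fun i _ => σ i) (by simp) (by simp) ?_
    intro j hj
    exact ⟨σ.symm j, by simpa using hj, by simp⟩
  rw [hσ, rowCount]
  rw [Finset.card_eq_sum_card_fiberwise (f := fun i => (tableau mu i).1.2)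
      (t := (diagram mu).cells.image Prod.snd)
      (fun i _ => by simpa using ⟨_, (tableau mu i).2⟩),
    Finset.card_eq_sum_card_fiberwise (f := Prod.snd) (t := (diagram mu).cells.image Prod.snd)
      (fun c hc => by
        simp only [Finset.coe_filter, Set.mem_ofPred_eq] at hc
        simpa using ⟨_, hc.1⟩)]
  refine Finset.sum_le_sum fun j _ => ?_
  have hmin : (((diagram mu).cells.filter fun c => c.1 < k).filter fun c => c.2 = j) =
      Finset.range (min k ((diagram mu).colLen j)) ×ˢ {j} := by
    ext ⟨a, b⟩
    simp only [Finset.mem_filter, YoungDiagram.mem_cells, YoungDiagram.mem_iff_lt_colLen,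
      Finset.mem_product, Finset.mem_range, Finset.mem_singleton, lt_min_iff]
    constructor
    · rintro ⟨⟨h1, h2⟩, rfl⟩
      exact ⟨⟨h2, h1⟩, rfl⟩
    · rintro ⟨⟨h1, h2⟩, rfl⟩
      exact ⟨⟨h2, h1⟩, rfl⟩
  rw [hmin, Finset.card_product, Finset.card_singleton, mul_one, Finset.card_range]
  refine le_min ?_ ?_
  · rw [← Finset.card_range k]
    refine Finset.card_le_card_of_injOn (fun i => (tableau lam (σ i)).1.1) ?_ ?_
    · intro i hi
      simp only [Finset.coe_filter, Finset.mem_filter, Finset.mem_univ, true_and,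
        Set.mem_ofPred_eq] at hi
      simpa using hi.1
    · intro i hi i' hi' hrow
      simp only [Finset.coe_filter, Finset.mem_filter, Finset.mem_univ, true_and,
        Set.mem_ofPred_eq] at hi hi'
      by_contra hne
      exact h i i' hne hrow (hi.2.trans hi'.2.symm)
  · rw [YoungDiagram.colLen_eq_card]
    refine Finset.card_le_card_of_injOn (fun i => (tableau mu i).1) ?_ ?_
    · intro i hi
      simp only [Finset.coe_filter, Finset.mem_filter, Finset.mem_univ, true_and,
        Set.mem_ofPred_eq] at hi
      rw [Finset.mem_coe, YoungDiagram.mem_col_iff, ← YoungDiagram.mem_cells]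
      exact ⟨(tableau mu i).2, hi.2⟩
    · intro i _ i' _ hii
      exact (tableau mu).injective (Subtype.ext hii)

/-- The sum over the row stabilizer, the left factor of the Young symmetrizer. -/
noncomputable def rowSum {n : ℕ} (lam : n.Partition) :
    MonoidAlgebra ℂ (Equiv.Perm (Fin n)) :=
  ∑ g ∈ rowStabilizer lam, MonoidAlgebra.of ℂ (Equiv.Perm (Fin n)) g

/-- The signed sum over the column stabilizer, the right factor of the Young symmetrizer. -/
noncomputable def columnSum {n : ℕ} (lam : n.Partition) :
    MonoidAlgebra ℂ (Equiv.Perm (Fin n)) :=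
  ∑ g ∈ columnStabilizer lam,
    ((Equiv.Perm.sign g : ℤ) : ℂ) • MonoidAlgebra.of ℂ (Equiv.Perm (Fin n)) g

theorem rowSum_mul_of {n : ℕ} (lam : n.Partition) {t : Equiv.Perm (Fin n)}
    (ht : ∀ i, (tableau lam (t i)).1.1 = (tableau lam i).1.1) :
    rowSum lam * MonoidAlgebra.of ℂ _ t = rowSum lam := by
  rw [rowSum, Finset.sum_mul]
  refine Finset.sum_bij' (fun g _ => g * t) (fun g _ => g * t⁻¹) ?_ ?_ ?_ ?_ ?_
  · intro g hg
    simp only [rowStabilizer, Finset.mem_filter, Finset.mem_univ, true_and] at hg ⊢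
    intro i
    rw [Equiv.Perm.mul_apply, hg, ht]
  · intro g hg
    simp only [rowStabilizer, Finset.mem_filter, Finset.mem_univ, true_and] at hg ⊢
    intro i
    simpa [hg] using (ht (t⁻¹ i)).symm
  · simp
  · simp
  · intro g _
    rw [map_mul]

theorem of_mul_columnSum {n : ℕ} (lam : n.Partition) {t : Equiv.Perm (Fin n)}
    (ht : ∀ i, (tableau lam (t i)).1.2 = (tableau lam i).1.2)
    (hsign : Equiv.Perm.sign t = -1) :
    MonoidAlgebra.of ℂ _ t * columnSum lam = -columnSum lam := by
  rw [columnSum, Finset.mul_sum, ← Finset.sum_neg_distrib]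
  refine Finset.sum_bij' (fun g _ => t * g) (fun g _ => t⁻¹ * g) ?_ ?_ ?_ ?_ ?_
  · intro g hg
    simp only [columnStabilizer, Finset.mem_filter, Finset.mem_univ, true_and] at hg ⊢
    intro i
    rw [Equiv.Perm.mul_apply, ht, hg]
  · intro g hg
    simp only [columnStabilizer, Finset.mem_filter, Finset.mem_univ, true_and] at hg ⊢
    intro i
    simpa [hg] using (ht (t⁻¹ (g i))).symm
  · simp
  · simp
  · intro g _
    rw [map_mul, map_mul, hsign, mul_smul_comm]
    simp

/-- Two entries in one row of `lam` and, after permuting by `σ`, in one column of `mu`, give a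
transposition that `rowSum lam` absorbs and that changes the sign of `columnSum mu`. -/
theorem rowSum_mul_of_mul_columnSum {n : ℕ} {lam mu : n.Partition}
    (h : ¬ ∀ k, rowCount lam k ≤ rowCount mu k) (σ : Equiv.Perm (Fin n)) :
    rowSum lam * MonoidAlgebra.of ℂ _ σ * columnSum mu = 0 := by
  have hpair : ∃ i j, i ≠ j ∧ (tableau lam (σ i)).1.1 = (tableau lam (σ j)).1.1 ∧
      (tableau mu i).1.2 = (tableau mu j).1.2 := by
    by_contra! hno
    exact h (rowCount_le_of_separated lam mu σ hno)
  obtain ⟨i, j, hij, hrow, hcol⟩ := hpair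
  have hswap {β : Type} (F : Fin n → β) (a b : Fin n) (hF : F a = F b) (k : Fin n) :
      F (Equiv.swap a b k) = F k := by
    rw [Equiv.swap_apply_def]
    split_ifs with h1 h2
    · rw [h1, hF]
    · rw [h2, hF]
    · rfl
  have hr := rowSum_mul_of lam (hswap (fun k => (tableau lam k).1.1) (σ i) (σ j) hrow)
  have hc := of_mul_columnSum mu (hswap (fun k => (tableau mu k).1.2) i j hcol)
    (Equiv.Perm.sign_swap hij)
  have hcomm : Equiv.swap (σ i) (σ j) * σ = σ * Equiv.swap i j := by
    rw [Equiv.mul_swap_eq_swap_mul]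
  have hneg : rowSum lam * MonoidAlgebra.of ℂ _ σ * columnSum mu =
      -(rowSum lam * MonoidAlgebra.of ℂ _ σ * columnSum mu) := by
    conv_lhs =>
      rw [← hr, mul_assoc (rowSum lam), ← map_mul, hcomm, map_mul, ← mul_assoc, mul_assoc, hc,
        mul_neg]
  refine (IsUnit.mk0 (2 : ℂ) two_ne_zero).smul_eq_zero.1 ?_
  rw [two_smul]
  exact eq_neg_iff_add_eq_zero.1 hneg

/-- A semisimple ring is von Neumann regular, so it has no nonzero element `v` with `v R v = 0`. -/
theorem eq_zero_of_mul_mul_self_eq_zero {R : Type*} [Ring R] [IsSemisimpleRing R] {v : R}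
    (h : ∀ x, v * x * v = 0) : v = 0 := by
  obtain ⟨e, he, hspan⟩ := IsSemisimpleRing.ideal_eq_span_idempotent (Ideal.span {v})
  obtain ⟨r, hr⟩ := Ideal.mem_span_singleton'.1
    (hspan ▸ Ideal.mem_span_singleton_self e : e ∈ Ideal.span {v})
  obtain ⟨a, ha⟩ := Ideal.mem_span_singleton'.1
    (hspan ▸ Ideal.mem_span_singleton_self v : v ∈ Ideal.span {e})
  calc v = v * e := by rw [← ha, mul_assoc, he.eq]
    _ = 0 := by rw [← hr, ← mul_assoc, h]

theorem youngSymmetrizer_mul_mul_of_not_dominated {n : ℕ} {lam mu : n.Partition}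
    (h : ¬ ∀ k, rowCount lam k ≤ rowCount mu k) (x : MonoidAlgebra ℂ (Equiv.Perm (Fin n))) :
    youngSymmetrizer lam * x * youngSymmetrizer mu = 0 := by
  have hzero (y : MonoidAlgebra ℂ (Equiv.Perm (Fin n))) :
      rowSum lam * y * columnSum mu = 0 := by
    induction y using MonoidAlgebra.induction_linear with
    | zero => simp
    | add y z hy hz => rw [mul_add, add_mul, hy, hz, add_zero]
    | single g r =>
      have hg := rowSum_mul_of_mul_columnSum h g
      rw [MonoidAlgebra.of_apply] at hg
      rw [show MonoidAlgebra.single g r = r • MonoidAlgebra.single g (1 : ℂ) by simp,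
        mul_smul_comm, smul_mul_assoc, hg, smul_zero]
  calc youngSymmetrizer lam * x * youngSymmetrizer mu
      = rowSum lam * (columnSum lam * x * rowSum mu) * columnSum mu := by
        change rowSum lam * columnSum lam * x * (rowSum mu * columnSum mu) = _
        simp only [mul_assoc]
    _ = 0 := hzero _

/-- The two-sided ideals generated by the Young symmetrizers of different partitions annihilate
each other. One order follows from dominance, the other one from it because the group algebra
is semisimple. -/
theorem youngSymmetrizer_mul_mul_eq_zero {n : ℕ} {lam mu : n.Partition} (h : lam ≠ mu)
    (x : MonoidAlgebra ℂ (Equiv.Perm (Fin n))) :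
    youngSymmetrizer lam * x * youngSymmetrizer mu = 0 := by
  by_cases hle : ∀ k, rowCount lam k ≤ rowCount mu k
  · have hge : ¬ ∀ k, rowCount mu k ≤ rowCount lam k := fun hge =>
      h (eq_of_rowCount_eq fun k => (hle k).antisymm (hge k))
    refine eq_zero_of_mul_mul_self_eq_zero fun y => ?_
    calc youngSymmetrizer lam * x * youngSymmetrizer mu * y *
          (youngSymmetrizer lam * x * youngSymmetrizer mu)
        = youngSymmetrizer lam * x * (youngSymmetrizer mu * y * youngSymmetrizer lam) *
            (x * youngSymmetrizer mu) := by simp only [mul_assoc]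
      _ = 0 := by
        rw [youngSymmetrizer_mul_mul_of_not_dominated hge, mul_zero, zero_mul]
  · exact youngSymmetrizer_mul_mul_of_not_dominated hle x

theorem youngSymmetrizer_mul_smul_eq_zero {n : ℕ} {lam mu : n.Partition} (h : lam ≠ mu)
    (x : MonoidAlgebra ℂ (Equiv.Perm (Fin n))) (v : SpechtModule mu) :
    (youngSymmetrizer lam * x) • v = 0 := by
  obtain ⟨a, ha⟩ := Submodule.mem_span_singleton.1 v.2
  apply Subtype.ext
  rw [Submodule.coe_smul, ← ha, smul_eq_mul, smul_eq_mul, mul_assoc, ← mul_assoc x,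
    ← mul_assoc, youngSymmetrizer_mul_mul_eq_zero h, Submodule.coe_zero]

theorem eq_zero_of_youngSymmetrizer_mul_smul_eq_zero {n : ℕ} {lam : n.Partition}
    {v : SpechtModule lam}
    (h : ∀ x : MonoidAlgebra ℂ (Equiv.Perm (Fin n)), (youngSymmetrizer lam * x) • v = 0) :
    v = 0 := by
  obtain ⟨a, ha⟩ := Submodule.mem_span_singleton.1 v.2
  apply Subtype.ext
  refine eq_zero_of_mul_mul_self_eq_zero fun x => ?_
  have hx := congrArg Subtype.val (h x)
  rw [Submodule.coe_smul, Submodule.coe_zero, smul_eq_mul] at hx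
  calc (v : MonoidAlgebra ℂ (Equiv.Perm (Fin n))) * x * v
      = a * (youngSymmetrizer lam * x * v) := by
        rw [← ha, smul_eq_mul]
        simp only [mul_assoc]
    _ = 0 := by rw [hx, mul_zero]

/-! ### Specht modules and the exchange of the two halves -/

theorem specht_apply {n : ℕ} (lam : n.Partition) (g : Equiv.Perm (Fin n)) (v : SpechtModule lam) :
    specht lam g v = MonoidAlgebra.single g (1 : ℂ) • v := by
  simp [specht, Representation.ofModule']

theorem rid_lTensor_rTensor {M N : Type*} [AddCommGroup M] [Module ℂ M] [AddCommGroup N]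
    [Module ℂ N] (T : M →ₗ[ℂ] M) (ξ : N →ₗ[ℂ] ℂ) (u : M ⊗[ℂ] N) :
    TensorProduct.rid ℂ M (ξ.lTensor M (T.rTensor N u)) =
      T (TensorProduct.rid ℂ M (ξ.lTensor M u)) := by
  induction u with
  | zero => simp
  | add u v hu hv => simp only [map_add, hu, hv]
  | tmul v w => simp

theorem eq_zero_of_rTensor_youngSymmetrizer_eq_zero {n : ℕ} {lam : n.Partition} {W : Type*}
    [AddCommGroup W] [Module ℂ W] {t : SpechtModule lam ⊗[ℂ] W}
    (h : ∀ x : MonoidAlgebra ℂ (Equiv.Perm (Fin n)),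
      (Algebra.lsmul ℂ ℂ (SpechtModule lam) (youngSymmetrizer lam * x)).rTensor W t = 0) :
    t = 0 := by
  classical
  let b := Module.Free.chooseBasis ℂ W
  apply (TensorProduct.equivFinsuppOfBasisRight b).injective
  rw [map_zero]
  ext1 i
  rw [TensorProduct.equivFinsuppOfBasisRight_apply, Finsupp.zero_apply]
  refine eq_zero_of_youngSymmetrizer_mul_smul_eq_zero fun x => ?_
  have hx := rid_lTensor_rTensor (Algebra.lsmul ℂ ℂ (SpechtModule lam) (youngSymmetrizer lam * x))
    (b.coord i) t
  rw [h, LinearMap.map_zero, LinearEquiv.map_zero] at hx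
  exact hx.symm

/-- The identification of `{0, …, 2m - 1}` with two copies of `{0, …, m - 1}` that underlies
`youngEmbedding`. -/
def halves (m : ℕ) : Fin m ⊕ Fin m ≃ Fin (2 * m) :=
  finSumFinEquiv.trans (finCongr (two_mul m).symm)

/-- The involution of `{0, …, 2m - 1}` exchanging the two halves, `i ↔ m + i` for `i < m`. -/
def halvesSwap (m : ℕ) : Equiv.Perm (Fin (2 * m)) :=
  (halves m).permCongr (Equiv.sumComm (Fin m) (Fin m))

theorem halves_inl_lt {m : ℕ} (i : Fin m) : (halves m (Sum.inl i)).val < m := by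
  simp [halves]

theorem not_halves_inr_lt {m : ℕ} (i : Fin m) : ¬ (halves m (Sum.inr i)).val < m := by
  simp [halves]

theorem youngEmbedding_halves {m : ℕ} (x : Equiv.Perm (Fin m) × Equiv.Perm (Fin m))
    (i : Fin m ⊕ Fin m) :
    youngEmbedding m x (halves m i) = halves m (Sum.map x.1 x.2 i) := by
  change halves m (Sum.map x.1 x.2 ((halves m).symm (halves m i))) = _
  rw [Equiv.symm_apply_apply]

theorem halvesSwap_halves {m : ℕ} (i : Fin m ⊕ Fin m) :
    halvesSwap m (halves m i) = halves m i.swap := by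
  rw [halvesSwap, Equiv.permCongr_apply, Equiv.symm_apply_apply, Equiv.sumComm_apply]

theorem youngEmbedding_mul_halvesSwap {m : ℕ} (a b : Equiv.Perm (Fin m)) :
    youngEmbedding m (a, b) * halvesSwap m = halvesSwap m * youngEmbedding m (b, a) := by
  refine Equiv.ext fun i => ?_
  obtain ⟨i, rfl⟩ := (halves m).surjective i
  rw [Equiv.Perm.mul_apply, Equiv.Perm.mul_apply, halvesSwap_halves, youngEmbedding_halves,
    youngEmbedding_halves, halvesSwap_halves]
  rcases i with i | i <;> rfl

theorem youngEmbedding_injective (m : ℕ) : Function.Injective (youngEmbedding m) :=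
  (halves m).permCongrHom.injective.comp Equiv.Perm.sumCongrHom_injective

theorem youngEmbedding_apply_lt_iff {m : ℕ} (x : Equiv.Perm (Fin m) × Equiv.Perm (Fin m))
    (i : Fin (2 * m)) : (youngEmbedding m x i).val < m ↔ i.val < m := by
  obtain ⟨i, rfl⟩ := (halves m).surjective i
  rw [youngEmbedding_halves]
  rcases i with i | i
  · exact iff_of_true (halves_inl_lt _) (halves_inl_lt _)
  · exact iff_of_false (not_halves_inr_lt _) (not_halves_inr_lt _)

theorem halvesSwap_apply_lt_iff {m : ℕ} (i : Fin (2 * m)) :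
    (halvesSwap m i).val < m ↔ ¬ i.val < m := by
  obtain ⟨i, rfl⟩ := (halves m).surjective i
  rw [halvesSwap_halves]
  rcases i with i | i
  · exact iff_of_false (not_halves_inr_lt _) (not_not.2 (halves_inl_lt _))
  · exact iff_of_true (halves_inl_lt _) (not_halves_inr_lt _)

theorem mem_range_youngEmbedding {m : ℕ} {σ : Equiv.Perm (Fin (2 * m))}
    (h : ∀ i, i.val < m → (σ i).val < m) : σ ∈ (youngEmbedding m).range := by
  have hmem : (halves m).symm.permCongr σ ∈ (Equiv.Perm.sumCongrHom (Fin m) (Fin m)).range := by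
    apply Equiv.Perm.mem_sumCongrHom_range_of_perm_mapsTo_inl
    rintro _ ⟨i, rfl⟩
    have hi := h (halves m (Sum.inl i)) (halves_inl_lt i)
    obtain ⟨j, hj⟩ := (halves m).surjective (σ (halves m (Sum.inl i)))
    rw [← hj] at hi
    rcases j with j | j
    · exact ⟨j, by simp [Equiv.permCongr_apply, ← hj]⟩
    · exact absurd hi (not_halves_inr_lt j)
  obtain ⟨x, hx⟩ := hmem
  refine ⟨x, ?_⟩
  change (halves m).permCongr (Equiv.Perm.sumCongrHom (Fin m) (Fin m) x) = σ
  rw [hx]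
  ext i
  simp [Equiv.permCongr_apply]

theorem rTensor_lsmul_single {m : ℕ} (mu1 mu2 : m.Partition) (g : Equiv.Perm (Fin m)) (r : ℂ)
    (t : SpechtModule mu1 ⊗[ℂ] SpechtModule mu2) :
    (Algebra.lsmul ℂ ℂ (SpechtModule mu1) (MonoidAlgebra.single g r)).rTensor
      (SpechtModule mu2) t = r • outerTensor (specht mu1) (specht mu2) (g, 1) t := by
  have hg : Algebra.lsmul ℂ ℂ (SpechtModule mu1) (MonoidAlgebra.single g r) =
      r • specht mu1 g := by
    ext1 v
    rw [LinearMap.smul_apply, specht_apply, Algebra.lsmul_coe, ← smul_assoc]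
    simp
  change _ = r • TensorProduct.map (specht mu1 g) (specht mu2 1) t
  rw [hg, map_one, LinearMap.rTensor_smul, LinearMap.smul_apply]
  rfl

theorem lTensor_lsmul_single {m : ℕ} (mu1 mu2 : m.Partition) (g : Equiv.Perm (Fin m)) (r : ℂ)
    (t : SpechtModule mu1 ⊗[ℂ] SpechtModule mu2) :
    (Algebra.lsmul ℂ ℂ (SpechtModule mu2) (MonoidAlgebra.single g r)).lTensor
      (SpechtModule mu1) t = r • outerTensor (specht mu1) (specht mu2) (1, g) t := by
  have hg : Algebra.lsmul ℂ ℂ (SpechtModule mu2) (MonoidAlgebra.single g r) =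
      r • specht mu2 g := by
    ext1 v
    rw [LinearMap.smul_apply, specht_apply, Algebra.lsmul_coe, ← smul_assoc]
    simp
  change _ = r • TensorProduct.map (specht mu1 1) (specht mu2 g) t
  rw [hg, map_one, LinearMap.lTensor_smul, LinearMap.smul_apply]
  rfl

/-- For `mu1 ≠ mu2` a copy of `χ_{mu1} × χ_{mu2}` meets its translate under `halvesSwap` trivially:
the translate is a copy of `χ_{mu2} × χ_{mu1}`, so the Young symmetrizer of `mu1` in the first
factor kills it, whereas no nonzero vector of the first copy is killed by the ideal of that
symmetrizer. -/
theorem eq_zero_of_map_eq_halvesSwap_map {m : ℕ} {mu1 mu2 : m.Partition} (hmu : mu1 ≠ mu2)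
    {V : Type*} [AddCommGroup V] [Module ℂ V] {σ : Representation ℂ (Equiv.Perm (Fin (2 * m))) V}
    (f : Representation.IntertwiningMap (outerTensor (specht mu1) (specht mu2))
      (σ.comp (youngEmbedding m)))
    (hf : Function.Injective f) {t t' : SpechtModule mu1 ⊗[ℂ] SpechtModule mu2}
    (h : f t = σ (halvesSwap m) (f t')) : t = 0 := by
  have htransport (z : MonoidAlgebra ℂ (Equiv.Perm (Fin m))) :
      f ((Algebra.lsmul ℂ ℂ (SpechtModule mu1) z).rTensor (SpechtModule mu2) t) =
        σ (halvesSwap m)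
          (f ((Algebra.lsmul ℂ ℂ (SpechtModule mu2) z).lTensor (SpechtModule mu1) t')) := by
    induction z using MonoidAlgebra.induction_linear with
    | zero => simp
    | add y z hy hz =>
      simp only [map_add, LinearMap.rTensor_add, LinearMap.lTensor_add, LinearMap.add_apply, hy, hz]
    | single g r =>
      rw [rTensor_lsmul_single, lTensor_lsmul_single, map_smul, map_smul, map_smul,
        f.isIntertwining, f.isIntertwining, h]
      simp only [MonoidHom.comp_apply]
      rw [← Module.End.mul_apply, ← Module.End.mul_apply, ← map_mul, ← map_mul,
        youngEmbedding_mul_halvesSwap]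
  refine eq_zero_of_rTensor_youngSymmetrizer_eq_zero fun x => hf ?_
  have hkill : Algebra.lsmul ℂ ℂ (SpechtModule mu2) (youngSymmetrizer mu1 * x) = 0 :=
    LinearMap.ext fun v => youngSymmetrizer_mul_smul_eq_zero hmu x v
  rw [htransport, hkill, LinearMap.lTensor_zero, LinearMap.zero_apply, map_zero, map_zero]

/-! ### Injectivity on an induced representation -/

/-- Frobenius reciprocity for a subgroup `H` of index at most two with `D = H ∪ H w⁻¹`: an
`H`-equivariant map `ψ` whose image meets its translate by `w` trivially extends to an embedding
of the induced representation, which is spanned by the classes over `1` and `w⁻¹`. -/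
theorem isContained_ind {D A V : Type*} [Group D] [AddCommGroup A] [Module ℂ A]
    [AddCommGroup V] [Module ℂ V] {H : Subgroup D} {w : D} (hw : ∀ d, d ∈ H ∨ d * w ∈ H)
    {ρ : Representation ℂ H A} {σ : Representation ℂ D V} (ψ : A →ₗ[ℂ] V)
    (hψ : ∀ (h : H) a, ψ (ρ h a) = σ h (ψ a))
    (hdisj : ∀ a a', ψ a = σ w (ψ a') → a = 0) :
    IsContained (Representation.ind H.subtype ρ) σ := by
  let F : Representation.IndV H.subtype ρ →ₗ[ℂ] V := Representation.Coinvariants.lift _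
    (TensorProduct.lift <| (Finsupp.lift _ _ _ fun d => σ d⁻¹ ∘ₗ ψ) ∘ₗ
      (MonoidAlgebra.coeffLinearEquiv ℂ).toLinearMap)
    fun h ↦ by
      ext d a
      simp only [LinearMap.coe_comp, Function.comp_apply, MonoidAlgebra.lsingle_apply]
      simp [Representation.ofMulAction_single, mul_inv_rev, hψ]
  have hF (d : D) (a : A) : F (Representation.IndV.mk H.subtype ρ d a) = σ d⁻¹ (ψ a) := by
    simp [F]
  have hmove (h : H) (d : D) (a : A) : Representation.IndV.mk H.subtype ρ (h * d) a =
      Representation.IndV.mk H.subtype ρ d (ρ h⁻¹ a) := by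
    simp
  have hspan (x : Representation.IndV H.subtype ρ) : ∃ a a',
      x = Representation.IndV.mk H.subtype ρ 1 a + Representation.IndV.mk H.subtype ρ w⁻¹ a' := by
    induction x using Representation.Coinvariants.induction_on with
    | _ x =>
    induction x with
    | zero => exact ⟨0, 0, by simp⟩
    | add x y hx hy =>
      obtain ⟨a, a', hx⟩ := hx
      obtain ⟨b, b', hy⟩ := hy
      refine ⟨a + b, a' + b', ?_⟩
      rw [map_add, map_add, map_add, hx, hy]
      abel
    | tmul z a =>
      induction z using MonoidAlgebra.induction_linear with
      | zero => exact ⟨0, 0, by simp⟩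
      | add x y hx hy =>
        obtain ⟨a, a', hx⟩ := hx
        obtain ⟨b, b', hy⟩ := hy
        refine ⟨a + b, a' + b', ?_⟩
        rw [TensorProduct.add_tmul, map_add, map_add, map_add, hx, hy]
        abel
      | single d r =>
        have hr : Representation.Coinvariants.mk
            (Representation.tprod ((Representation.leftRegular ℂ D).comp H.subtype) ρ)
              (MonoidAlgebra.single d r ⊗ₜ a) = Representation.IndV.mk H.subtype ρ d (r • a) := by
          change _ = Representation.Coinvariants.mk _ (MonoidAlgebra.single d 1 ⊗ₜ (r • a))
          rw [← TensorProduct.smul_tmul]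
          simp
        rw [hr]
        rcases hw d with hd | hd
        · exact ⟨ρ (⟨d, hd⟩ : H)⁻¹ (r • a), 0, by
            rw [← hmove ⟨d, hd⟩ 1, map_zero, add_zero, mul_one]⟩
        · exact ⟨0, ρ (⟨d * w, hd⟩ : H)⁻¹ (r • a), by
            rw [← hmove ⟨d * w, hd⟩ w⁻¹, map_zero, zero_add, mul_inv_cancel_right]⟩
  refine ⟨⟨F, fun d => ?_⟩, ?_⟩
  · refine Representation.IndV.hom_ext _ _ fun d' => LinearMap.ext fun a => ?_
    change F (Representation.ind H.subtype ρ d (Representation.IndV.mk H.subtype ρ d' a)) =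
      σ d (F (Representation.IndV.mk H.subtype ρ d' a))
    rw [Representation.ind_mk, hF, hF, mul_inv_rev, inv_inv, map_mul, Module.End.mul_apply]
  · refine (injective_iff_map_eq_zero F).2 fun x hx => ?_
    obtain ⟨a, a', rfl⟩ := hspan x
    rw [map_add, hF, hF, inv_one, map_one, inv_inv, Module.End.one_apply] at hx
    have ha : a = 0 := hdisj a (-a') (by
      rw [map_neg, map_neg]
      exact eq_neg_of_add_eq_zero_left hx)
    have ha' : a' = 0 := by
      refine hdisj a' 0 ?_
      rw [ha, map_zero, zero_add] at hx
      rw [map_zero, map_zero, ← σ.inv_self_apply w (ψ a'), hx, map_zero]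
    rw [ha, ha', map_zero, map_zero, add_zero]

/-! ### The dihedral group and its subgroup preserving parity -/

theorem val_finRotate {n : ℕ} (i : Fin n) :
    (finRotate n i).val = if i.val + 1 = n then 0 else i.val + 1 := by
  cases n with
  | zero => exact i.elim0
  | succ n =>
    rw [coe_finRotate]
    simp only [Fin.ext_iff, Fin.val_last, Nat.add_right_cancel_iff]

theorem finRotate_induction {n : ℕ} (hn : 0 < n) {R : Fin n → Prop} (zero : R ⟨0, hn⟩)
    (rotate : ∀ i, R i → R (finRotate n i)) (i : Fin n) : R i := by
  obtain ⟨k, hk⟩ := i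
  induction k with
  | zero => exact zero
  | succ k ih =>
    have hk' : k < n := k.lt_succ_self.trans hk
    convert rotate ⟨k, hk'⟩ (ih hk')
    rw [val_finRotate, if_neg hk.ne]

/-- The reflection `i ↦ n - 1 - i` of `{0, …, n - 1}`, as an element of `D_n`. -/
def reversal (n : ℕ) : dihedral n :=
  ⟨Fin.revPerm, Subgroup.subset_closure (Set.mem_insert_of_mem _ rfl)⟩

theorem reversal_mul_reversal (n : ℕ) : reversal n * reversal n = 1 := by
  apply Subtype.ext
  ext i
  simp [reversal]

theorem reversal_mul_rotation (n : ℕ) :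
    reversal n * rotation n = (rotation n)⁻¹ * reversal n := by
  rw [eq_inv_mul_iff_mul_eq]
  apply Subtype.ext
  ext i
  simp only [reversal, rotation, Subgroup.coe_mul, Equiv.Perm.mul_apply, Fin.revPerm_apply,
    val_finRotate, Fin.val_rev]
  split_ifs <;> omega

/-- A reflection of `D_{2m}` preserving the parity of the points, `i ↦ -i` modulo `2m`. -/
def parityReflection (m : ℕ) : dihedral (2 * m) :=
  rotation (2 * m) * reversal (2 * m)

theorem isReflection_parityReflection {m : ℕ} (hm : 1 < m) :
    IsReflection (parityReflection m) := by
  intro h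
  obtain ⟨k, hk⟩ := Subgroup.mem_zpowers_iff.1 h
  have hcomm : rotation (2 * m) * parityReflection m = parityReflection m * rotation (2 * m) := by
    rw [← hk]
    exact (Commute.refl _).zpow_right k
  have h0 := congrArg (fun d : dihedral (2 * m) => (d.1 ⟨0, by omega⟩).val) hcomm
  simp only [parityReflection, reversal, rotation, Subgroup.coe_mul, Equiv.Perm.mul_apply,
    Fin.revPerm_apply, val_finRotate, Fin.val_rev] at h0
  split_ifs at h0 <;> omega

/-- The subgroup `⟨w ^ 2, s⟩` has index at most two in `D_{2m}`. -/
theorem mem_subgroupSq_or_mul_rotation_mem (m : ℕ) (d : dihedral (2 * m)) :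
    d ∈ subgroupSq (parityReflection m) ∨
      d * rotation (2 * m) ∈ subgroupSq (parityReflection m) := by
  set H := subgroupSq (parityReflection m)
  set w := rotation (2 * m)
  set r := reversal (2 * m)
  have hw2 : w ^ 2 ∈ H := Subgroup.subset_closure (Set.mem_insert _ _)
  have hs : w * r ∈ H := Subgroup.subset_closure (Set.mem_insert_of_mem _ rfl)
  have hrw : r * w = w⁻¹ * r := reversal_mul_rotation (2 * m)
  have hrr : r⁻¹ = r := inv_eq_of_mul_eq_one_left (reversal_mul_reversal (2 * m))
  have hreverse (x : dihedral (2 * m)) (hx : x ∈ H ∨ x * w ∈ H) :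
      x * r ∈ H ∨ x * r * w ∈ H := by
    rcases hx with hx | hx
    · right
      have : x * r * w = x * (w ^ 2)⁻¹ * (w * r) := by
        rw [mul_assoc x, hrw]; group
      rw [this]
      exact mul_mem (mul_mem hx (inv_mem hw2)) hs
    · left
      have : x * r = x * w * (w ^ 2)⁻¹ * (w * r) := by group
      rw [this]
      exact mul_mem (mul_mem hx (inv_mem hw2)) hs
  obtain ⟨x, hx⟩ := d
  induction hx using Subgroup.closure_induction_right with
  | one => exact Or.inl (one_mem _)
  | mul_right x hx y hy ih =>
    rcases hy with rfl | rfl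
    · change (⟨x, hx⟩ : dihedral (2 * m)) * w ∈ H ∨ (⟨x, hx⟩ : dihedral (2 * m)) * w * w ∈ H
      rcases ih with ih | ih
      · right
        rw [mul_assoc, ← pow_two]
        exact mul_mem ih hw2
      · exact Or.inl ih
    · exact hreverse _ ih
  | mul_inv_cancel x hx y hy ih =>
    rcases hy with rfl | rfl
    · change (⟨x, hx⟩ : dihedral (2 * m)) * w⁻¹ ∈ H ∨ (⟨x, hx⟩ : dihedral (2 * m)) * w⁻¹ * w ∈ H
      rcases ih with ih | ih
      · right
        rwa [inv_mul_cancel_right]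
      · left
        have : (⟨x, hx⟩ : dihedral (2 * m)) * w⁻¹ =
            (⟨x, hx⟩ : dihedral (2 * m)) * w * (w ^ 2)⁻¹ := by group
        rw [this]
        exact mul_mem ih (inv_mem hw2)
    · change (⟨x, hx⟩ : dihedral (2 * m)) * r⁻¹ ∈ H ∨ (⟨x, hx⟩ : dihedral (2 * m)) * r⁻¹ * w ∈ H
      rw [hrr]
      exact hreverse _ ih

theorem val_mod_two_of_mem_subgroupSq {m : ℕ} {d : dihedral (2 * m)}
    (hd : d ∈ subgroupSq (parityReflection m)) (i : Fin (2 * m)) :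
    (d.1 i).val % 2 = i.val % 2 := by
  induction hd using Subgroup.closure_induction generalizing i with
  | one => rfl
  | mem d hd =>
    rcases hd with rfl | rfl
    · simp only [rotation, pow_two, Subgroup.coe_mul, Equiv.Perm.mul_apply, val_finRotate]
      split_ifs <;> omega
    · simp only [parityReflection, rotation, reversal, Subgroup.coe_mul, Equiv.Perm.mul_apply,
        val_finRotate, Fin.revPerm_apply, Fin.val_rev]
      split_ifs <;> omega
  | mul x y _ _ hx hy => exact (hx _).trans (hy _)
  | inv x _ hx =>
    rw [← hx]
    simp

/-- The permutation sending the lower half to the even points and the upper half to the odd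
points. -/
noncomputable def interleave (m : ℕ) : Equiv.Perm (Fin (2 * m)) :=
  Equiv.ofBijective
    (fun i => if h : i.val < m then ⟨2 * i.val, by omega⟩ else ⟨2 * (i.val - m) + 1, by omega⟩)
    (Finite.injective_iff_bijective.1 fun i j hij => by
      have := congrArg Fin.val hij
      ext
      split_ifs at this <;> dsimp only at this <;> omega)

theorem interleave_mod_two {m : ℕ} (i : Fin (2 * m)) :
    (interleave m i).val % 2 = 0 ↔ i.val < m := by
  rw [interleave, Equiv.ofBijective_apply]
  split_ifs with h <;> dsimp only <;> omega

theorem exists_isConjEmbedding (m : ℕ) :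
    ∃ g φ, IsConjEmbedding (subgroupSq (parityReflection m)) g φ := by
  have hmem (h : subgroupSq (parityReflection m)) :
      MulAut.conj (interleave m)⁻¹ h.1.1 ∈ (youngEmbedding m).range := by
    refine mem_range_youngEmbedding fun i hi => ?_
    rw [← interleave_mod_two] at hi ⊢
    simpa [hi] using val_mod_two_of_mem_subgroupSq h.2 (interleave m i)
  refine ⟨(interleave m)⁻¹,
    (MonoidHom.ofInjective (youngEmbedding_injective m)).symm.toMonoidHom.comp
      (((MulAut.conj (interleave m)⁻¹).toMonoidHom.comp
      ((dihedral (2 * m)).subtype.comp (subgroupSq (parityReflection m)).subtype)).codRestrict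
        (youngEmbedding m).range hmem), fun h => ?_⟩
  exact congrArg Subtype.val
    ((MonoidHom.ofInjective (youngEmbedding_injective m)).apply_symm_apply ⟨_, hmem h⟩)

/-- A conjugation carrying `w ^ 2` into the Young subgroup carries the two orbits of `w ^ 2` to the
two halves, so it carries the rotation `w`, which exchanges these orbits, to a permutation
exchanging the halves. -/
theorem exists_conj_rotation_eq {m : ℕ} (hm : 0 < m) {g : Equiv.Perm (Fin (2 * m))}
    {x : Equiv.Perm (Fin m) × Equiv.Perm (Fin m)}
    (hx : youngEmbedding m x = g * finRotate (2 * m) ^ 2 * g⁻¹) :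
    ∃ y, g * finRotate (2 * m) * g⁻¹ = halvesSwap m * youngEmbedding m y := by
  set w := finRotate (2 * m)
  have hw2 (i : Fin (2 * m)) : (g (w (w i))).val < m ↔ (g i).val < m := by
    rw [← youngEmbedding_apply_lt_iff x (g i), hx]
    simp [pow_two]
  have hw (i : Fin (2 * m)) : (g (w i)).val < m ↔ ¬ (g i).val < m := by
    have hstep (i : Fin (2 * m)) (hi : (g (w i)).val < m ↔ (g i).val < m) :
        (g (w (w i))).val < m ↔ (g (w i)).val < m := by rw [hw2, hi]
    have hpos : 0 < 2 * m := by omega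
    -- If `w` fixed the half of one point, it would fix the half of every point.
    have hzero : ¬ ((g (w ⟨0, hpos⟩)).val < m ↔ (g ⟨0, hpos⟩).val < m) := by
      intro h0
      have hinv := finRotate_induction hpos
        (R := fun i => (g (w i)).val < m ↔ (g i).val < m) h0 hstep
      have hconst := finRotate_induction hpos
        (R := fun i => (g i).val < m ↔ (g ⟨0, hpos⟩).val < m) Iff.rfl
        (fun i hi => (hinv i).trans hi)
      have h1 := hconst (g⁻¹ ⟨0, hpos⟩)
      have h2 := hconst (g⁻¹ ⟨m, by omega⟩)
      rw [Equiv.Perm.inv_def, Equiv.apply_symm_apply] at h1 h2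
      exact absurd (h2.2 (h1.1 hm)) (lt_irrefl m)
    refine finRotate_induction hpos (R := fun i => (g (w i)).val < m ↔ ¬ (g i).val < m) ?_ ?_ i
    · tauto
    · intro i hi
      change (g (w (w i))).val < m ↔ ¬ (g (w i)).val < m
      rw [hw2, hi, not_not]
  have hmem : (halvesSwap m)⁻¹ * (g * w * g⁻¹) ∈ (youngEmbedding m).range := by
    refine mem_range_youngEmbedding fun i hi => ?_
    rw [← not_not (a := _ < m), ← halvesSwap_apply_lt_iff]
    simpa using (not_congr (hw (g⁻¹ i))).2 (by simpa using hi)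
  obtain ⟨y, hy⟩ := hmem
  exact ⟨y, by rw [hy, mul_inv_cancel_left]⟩

/-- The restriction to `D_{2m}` of any representation of `S_{2m}` containing `χ_{mu1} × χ_{mu2}`
contains the representation induced from the subgroup preserving parity. -/
theorem isContained_ind_outerTensor {m : ℕ} (hm : 0 < m) {mu1 mu2 : m.Partition} (hmu : mu1 ≠ mu2)
    {V : Type*} [AddCommGroup V] [Module ℂ V] {σ : Representation ℂ (Equiv.Perm (Fin (2 * m))) V}
    (hσ : IsContained (outerTensor (specht mu1) (specht mu2)) (σ.comp (youngEmbedding m)))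
    {g : Equiv.Perm (Fin (2 * m))}
    {φ : subgroupSq (parityReflection m) →* Equiv.Perm (Fin m) × Equiv.Perm (Fin m)}
    (hφ : IsConjEmbedding (subgroupSq (parityReflection m)) g φ) :
    IsContained
      (Representation.ind (A := SpechtModule mu1 ⊗[ℂ] SpechtModule mu2)
        (subgroupSq (parityReflection m)).subtype
        ((outerTensor (specht mu1) (specht mu2)).comp φ))
      (σ.comp (dihedral (2 * m)).subtype) := by
  obtain ⟨f, hf⟩ := hσ
  have hfσ (x : Equiv.Perm (Fin m) × Equiv.Perm (Fin m)) (a) :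
      f (outerTensor (specht mu1) (specht mu2) x a) = σ (youngEmbedding m x) (f a) :=
    f.isIntertwining _ _ x a
  obtain ⟨y, hy⟩ := exists_conj_rotation_eq hm
    (hφ ⟨rotation (2 * m) ^ 2, Subgroup.subset_closure (Set.mem_insert _ _)⟩)
  refine isContained_ind (w := rotation (2 * m)) (mem_subgroupSq_or_mul_rotation_mem m)
    (σ g⁻¹ ∘ₗ f.toLinearMap) (fun h a => ?_) (fun a a' haa' => ?_)
  · change σ g⁻¹ (f (outerTensor (specht mu1) (specht mu2) (φ h) a)) = σ h.1.1 (σ g⁻¹ (f a))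
    rw [hfσ, hφ h, ← Module.End.mul_apply, ← Module.End.mul_apply, ← map_mul, ← map_mul,
      mul_assoc g, inv_mul_cancel_left]
  · change σ g⁻¹ (f a) = σ (finRotate (2 * m)) (σ g⁻¹ (f a')) at haa'
    refine eq_zero_of_map_eq_halvesSwap_map hmu f hf
      (t' := outerTensor (specht mu1) (specht mu2) y a') ?_
    rw [hfσ, ← Module.End.mul_apply, ← map_mul, ← hy, map_mul, map_mul, Module.End.mul_apply,
      Module.End.mul_apply, ← haa', Representation.self_inv_apply]

end DihedralRestriction

open DihedralRestriction in
theorem proposition3p2 (m : ℕ) (hm : 1 < m) (mu1 mu2 : m.Partition) (hmu : mu1 ≠ mu2)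
    (lam : (2 * m).Partition)
    (hlam : IsContained (outerTensor (specht mu1) (specht mu2))
      ((specht lam).comp (youngEmbedding m))) :
    ∃ s : dihedral (2 * m), IsReflection s ∧
      (∃ g φ, IsConjEmbedding (subgroupSq s) g φ) ∧
      ∀ g φ, IsConjEmbedding (subgroupSq s) g φ →
        IsContained
          (Representation.ind (A := SpechtModule mu1 ⊗[ℂ] SpechtModule mu2) (subgroupSq s).subtype
            ((outerTensor (specht mu1) (specht mu2)).comp φ))
          ((specht lam).comp (dihedral (2 * m)).subtype) := by
  -- Only the reflections preserving parity will do: with the others `H` is transitive.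
  exact ⟨parityReflection m, isReflection_parityReflection hm, exists_isConjEmbedding m,
    fun _ _ hφ => isContained_ind_outerTensor (zero_lt_one.trans hm) hmu hlam hφ⟩
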